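/- Let $n,t$ be natural numbers, let $\mathbb{R}[X]=\mathbb{R}[X_1,\dots,X_n]$, let $G\subseteq\mathbb{R}[X]$ be any (possibly infinite) set of polynomials, and put $S_G=\{x\in\mathbb{R}^n \mid g(x)\ge 0 \text{ for all } g\in G\}$. For a commutative ring $A$ and a subset $H\subseteq A$, the quadratic module generated by $H$ in $A$ is the set of all finite sums $\sum_i p_i^2h_i$ with $p_i\in A$ and $h_i\in\{1\}\cup H$. Let $Q_G$ be the quadratic module generated by $G$ in $\mathbb{R}[X]$, and suppose that $Q_G$ is archimedean, i.e., for every $a\in\mathbb{R}[X]$ there is $N\in\mathbb{N}$ with $N-a^2\in Q_G$. Let $f\in\mathbb{R}[X]^{t\times t}$ be a (not necessarily symmetric) matrix polynomial, and let $Q_G^f$ be the quadratic module generated by $G$ in the commutative subring $\mathbb{R}[X,f]$ of $\mathbb{R}[X]^{t\times t}$ generated by $f$ and $\mathbb{R}[X]$, where polynomials are identified with scalar matrices. Then the following are equivalent: (i) for all $x\in S_G$, all real eigenvalues of the real matrix $f(x)$ are nonnegative; (ii) $f+\varepsilon I_t\in Q_G^f$ for all real $\varepsilon>0$. -/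

import Mathlib

/-- A quadratic module of a commutative ring, the ring being endowed with the trivial involution. -/
structure IsQuadraticModule {A : Type*} [CommRing A] (M : Set A) : Prop where
  one_mem : (1 : A) ∈ M
  add_mem : ∀ a ∈ M, ∀ b ∈ M, a + b ∈ M
  sq_mul_mem : ∀ (p : A), ∀ a ∈ M, p ^ 2 * a ∈ M

/-- The quadratic module generated by `G` in a commutative ring with trivial involution:
the set of all finite sums `∑ pᵢ² gᵢ` with `gᵢ ∈ {1} ∪ G`. -/
def quadraticModule {A : Type*} [CommRing A] (G : Set A) : Set A :=
  {a | ∃ (N : ℕ) (p g : Fin N → A),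
    (∀ i, g i ∈ ({1} ∪ G : Set A)) ∧ a = ∑ i, p i ^ 2 * g i}

theorem isQuadraticModule_quadraticModule {A : Type*} [CommRing A] (G : Set A) :
    IsQuadraticModule (quadraticModule G) where
  one_mem := ⟨1, fun _ => 1, fun _ => 1, fun _ => Or.inl rfl, by simp⟩
  add_mem := by
    rintro a ⟨N, p, g, hg, rfl⟩ b ⟨N', p', g', hg', rfl⟩
    refine ⟨N + N', Fin.append p p', Fin.append g g', fun i => ?_, ?_⟩
    · refine Fin.addCases (fun i => ?_) (fun i => ?_) i
      · rw [Fin.append_left]; exact hg i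
      · rw [Fin.append_right]; exact hg' i
    · simp [Fin.sum_univ_add]
  sq_mul_mem := by
    rintro q a ⟨N, p, g, hg, rfl⟩
    refine ⟨N, fun i => q * p i, g, hg, ?_⟩
    rw [Finset.mul_sum]
    exact Finset.sum_congr rfl fun i _ => by ring

theorem subset_quadraticModule {A : Type*} [CommRing A] (G : Set A) :
    G ⊆ quadraticModule G :=
  fun a ha => ⟨1, fun _ => 1, fun _ => a, fun _ => Or.inr ha, by simp⟩

/-- `quadraticModule G` is the least quadratic module containing `G`. -/
theorem quadraticModule_subset {A : Type*} [CommRing A] {G M : Set A}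
    (hM : IsQuadraticModule M) (hG : G ⊆ M) : quadraticModule G ⊆ M := by
  rintro a ⟨N, p, g, hg, rfl⟩
  refine Finset.sum_induction _ (· ∈ M) (fun a b ha hb => hM.add_mem a ha b hb) ?_ fun i _ => ?_
  · simpa using hM.sq_mul_mem 0 1 hM.one_mem
  · refine hM.sq_mul_mem _ _ ?_
    rcases hg i with h | h
    · rw [Set.mem_singleton_iff.1 h]; exact hM.one_mem
    · exact hG h

/-- A subset `M` of a commutative ring (with trivial involution), usually a quadratic module,
is archimedean if for every `a` there is a natural number `N` with `N - a² ∈ M`. -/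
def IsArchimedeanModule {A : Type*} [CommRing A] (M : Set A) : Prop :=
  ∀ a : A, ∃ N : ℕ, (N : A) - a ^ 2 ∈ M

/-- The set `S_G` of the points of `ℝⁿ` at which all elements of `G` are nonnegative. -/
def nonnegSet {n : ℕ} (G : Set (MvPolynomial (Fin n) ℝ)) : Set (Fin n → ℝ) :=
  {x | ∀ g ∈ G, 0 ≤ MvPolynomial.eval x g}

/-- The value `f(x)` of a matrix polynomial `f` at a point `x` of `ℝⁿ`. -/
noncomputable def matrixEval {n t : ℕ} (x : Fin n → ℝ)
    (f : Matrix (Fin t) (Fin t) (MvPolynomial (Fin n) ℝ)) : Matrix (Fin t) (Fin t) ℝ :=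
  f.map (MvPolynomial.eval x)

/-- The ring `ℝ[X, f]`, generated inside the ring of matrix polynomials by `f` and
the polynomials, the latter being identified with scalar matrices. It is commutative, its operations being those of matrices. -/
noncomputable abbrev polyAdjoin {n t : ℕ} (f : Matrix (Fin t) (Fin t) (MvPolynomial (Fin n) ℝ)) :
    Subalgebra (MvPolynomial (Fin n) ℝ) (Matrix (Fin t) (Fin t) (MvPolynomial (Fin n) ℝ)) :=
  Algebra.adjoin (MvPolynomial (Fin n) ℝ) {f}

/-- `Q_G^f`: the quadratic module generated by `G` in the commutative ring `ℝ[X, f]` with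
trivial involution, as a set of matrix polynomials. -/
def quadraticModuleAdjoin {n t : ℕ} (G : Set (MvPolynomial (Fin n) ℝ))
    (f : Matrix (Fin t) (Fin t) (MvPolynomial (Fin n) ℝ)) :
    Set (Matrix (Fin t) (Fin t) (MvPolynomial (Fin n) ℝ)) :=
  Subtype.val ''
    quadraticModule (algebraMap (MvPolynomial (Fin n) ℝ) (polyAdjoin f) '' G)

/-! (ii) ⇒ (i): every element of ℝ[X, f] acts by a scalar on an eigenvector of f(x), and for x ∈ S_G
the elements of Q_G^f act by nonnegative scalars. So an eigenvalue r satisfies r + ε ≥ 0 for all ε >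
0.

(i) ⇒ (ii): by Jacobi's theorem (`mem_of_forall_algHom_pos`), an archimedean quadratic module M of a
real algebra contains every element that is positive at all real characters nonnegative on M. A
character φ of ℝ[X, f] nonnegative on the module restricts to evaluation at some x ∈ S_G, and
Cayley–Hamilton makes φ(f) an eigenvalue of f(x). Hence φ(f + ε) ≥ ε > 0.

The archimedean property passes from Q_G to ℝ[X, f] because this ring is integral over ℝ[X] and
boundedness is inherited by integral elements (`exists_sub_sq_mem_of_isIntegral`).

In the comments below, u ≤ v means v - u ∈ M. -/

namespace IsQuadraticModule

/-! ### Quadratic modules and sums of squares -/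

variable {A : Type*} [CommRing A] {M : Set A}

theorem sq_mem (hM : IsQuadraticModule M) (a : A) : a ^ 2 ∈ M := by
  simpa using hM.sq_mul_mem a 1 hM.one_mem

theorem zero_mem (hM : IsQuadraticModule M) : (0 : A) ∈ M := by
  simpa using hM.sq_mem 0

/-- Sums of squares are encoded as `quadraticModule ∅`, the least quadratic module. -/
theorem sumSq_mem (hM : IsQuadraticModule M) {σ : A} (hσ : σ ∈ quadraticModule (∅ : Set A)) :
    σ ∈ M :=
  quadraticModule_subset hM (Set.empty_subset M) hσ

theorem sumSq_mul_mem (hM : IsQuadraticModule M) {σ m : A}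
    (hσ : σ ∈ quadraticModule (∅ : Set A)) (hm : m ∈ M) : σ * m ∈ M := by
  have h : IsQuadraticModule {τ : A | τ * m ∈ M} :=
    { one_mem := by simpa using hm
      add_mem := fun a ha b hb => by
        simpa [add_mul] using hM.add_mem _ ha _ hb
      sq_mul_mem := fun p a ha => by
        simpa [mul_assoc] using hM.sq_mul_mem p _ ha }
  exact h.sumSq_mem hσ

/-- The quadratic module generated by a quadratic module `M` and one more element `a`. -/
theorem add_sumSq_mul (hM : IsQuadraticModule M) (a : A) :
    IsQuadraticModule {x : A | ∃ m ∈ M, ∃ σ ∈ quadraticModule (∅ : Set A), x = m + σ * a} where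
  one_mem := ⟨1, hM.one_mem, 0, (isQuadraticModule_quadraticModule _).zero_mem, by ring⟩
  add_mem := by
    rintro _ ⟨m, hm, σ, hσ, rfl⟩ _ ⟨m', hm', σ', hσ', rfl⟩
    exact ⟨m + m', hM.add_mem _ hm _ hm', σ + σ',
      (isQuadraticModule_quadraticModule _).add_mem _ hσ _ hσ', by ring⟩
  sq_mul_mem := by
    rintro p _ ⟨m, hm, σ, hσ, rfl⟩
    exact ⟨p ^ 2 * m, hM.sq_mul_mem _ _ hm, p ^ 2 * σ,
      (isQuadraticModule_quadraticModule _).sq_mul_mem _ _ hσ, by ring⟩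

theorem exists_maximal (hM : IsQuadraticModule M) (h : (-1 : A) ∉ M) :
    ∃ P, M ⊆ P ∧ Maximal (fun P : Set A => IsQuadraticModule P ∧ (-1 : A) ∉ P) P := by
  refine zorn_subset_nonempty {P : Set A | IsQuadraticModule P ∧ (-1 : A) ∉ P} ?_ M ⟨hM, h⟩
  rintro c hc hchain ⟨P₀, hP₀⟩
  refine ⟨⋃₀ c, ⟨⟨⟨P₀, hP₀, (hc hP₀).1.one_mem⟩, ?_, ?_⟩, ?_⟩,
    fun s hs => Set.subset_sUnion_of_mem hs⟩
  · rintro a ⟨P, hP, ha⟩ b ⟨P', hP', hb⟩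
    rcases hchain.total hP hP' with hle | hle
    · exact ⟨P', hP', (hc hP').1.add_mem _ (hle ha) _ hb⟩
    · exact ⟨P, hP, (hc hP).1.add_mem _ ha _ (hle hb)⟩
  · rintro p a ⟨P, hP, ha⟩
    exact ⟨P, hP, (hc hP).1.sq_mul_mem _ _ ha⟩
  · rintro ⟨P, hP, ha⟩
    exact (hc hP).2 ha

/-! ### Real algebras: semiorderings and Jacobi's theorem -/

variable [Algebra ℝ A]

theorem smul_mem (hM : IsQuadraticModule M) {r : ℝ} (hr : 0 ≤ r) {a : A} (ha : a ∈ M) :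
    r • a ∈ M := by
  have h := hM.sq_mul_mem (algebraMap ℝ A (√r)) a ha
  rwa [← map_pow, Real.sq_sqrt hr, ← Algebra.smul_def] at h

theorem algebraMap_mem (hM : IsQuadraticModule M) {r : ℝ} (hr : 0 ≤ r) :
    algebraMap ℝ A r ∈ M := by
  simpa [Algebra.smul_def] using hM.smul_mem hr hM.one_mem

theorem nonneg_of_algebraMap_mem (hM : IsQuadraticModule M) (h : (-1 : A) ∉ M) {r : ℝ}
    (hr : algebraMap ℝ A r ∈ M) : 0 ≤ r := by
  by_contra! hlt
  refine h ?_
  have := hM.smul_mem (r := (-r)⁻¹) (by simpa using hlt.le) hr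
  rwa [Algebra.smul_def, ← map_mul, inv_neg, neg_mul, inv_mul_cancel₀ hlt.ne, map_neg, map_one]
    at this

/-- Since 4a = (a + 1)² - (a - 1)², the support M ∩ -M is an ideal. -/
theorem mul_mem_of_neg_mem (hM : IsQuadraticModule M) {b : A} (hb : b ∈ M) (hb' : -b ∈ M)
    (a : A) : a * b ∈ M := by
  have h := hM.smul_mem (r := 1 / 4) (by norm_num)
    (hM.add_mem _ (hM.sq_mul_mem (a + 1) _ hb) _ (hM.sq_mul_mem (a - 1) _ hb'))
  have e : (a + 1) ^ 2 * b + (a - 1) ^ 2 * -b = (4 : ℝ) • (a * b) := by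
    rw [Algebra.smul_def, map_ofNat]; ring
  rwa [e, smul_smul, show (1 / 4 * 4 : ℝ) = 1 by norm_num, one_smul] at h

/-- If neither holds, maximality gives -1 = m + σa = m' - σ'a. Eliminating a puts -σ in M, so σ lies
in the ideal M ∩ -M; then σa ∈ M and -1 ∈ M. -/
theorem mem_or_neg_mem_of_maximal
    (hM : Maximal (fun P : Set A => IsQuadraticModule P ∧ (-1 : A) ∉ P) M) (a : A) :
    a ∈ M ∨ -a ∈ M := by
  have hQ := hM.prop.1
  have key : ∀ b ∉ M, ∃ m ∈ M, ∃ σ ∈ quadraticModule (∅ : Set A), -1 = m + σ * b := by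
    intro b hb
    by_contra hneg
    refine hb (hM.le_of_ge ⟨hQ.add_sumSq_mul b, hneg⟩ ?_ ?_)
    · exact fun m hm => ⟨m, hm, 0, (isQuadraticModule_quadraticModule _).zero_mem, by ring⟩
    · exact ⟨0, hQ.zero_mem, 1, (isQuadraticModule_quadraticModule _).one_mem, by ring⟩
  by_contra! hcon
  obtain ⟨m, hm, σ, hσ, h₁⟩ := key a hcon.1
  obtain ⟨m', hm', σ', hσ', h₂⟩ := key (-a) hcon.2
  have hneg : -σ ∈ M := by
    have h := hQ.add_mem _ (hQ.sumSq_mem hσ') _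
      (hQ.add_mem _ (hQ.sumSq_mul_mem hσ' hm) _ (hQ.sumSq_mul_mem hσ hm'))
    convert h using 1
    linear_combination σ' * h₁ + σ * h₂
  refine hM.prop.2 ?_
  rw [h₁, mul_comm]
  exact hQ.add_mem _ hm _ (hQ.mul_mem_of_neg_mem (hQ.sumSq_mem hσ) hneg a)

/-- An archimedean quadratic module which is a semiordering is contained in the nonnegativity
cone of a real point. -/
theorem exists_algHom_of_total (hM : IsQuadraticModule M) (h1 : (-1 : A) ∉ M)
    (htot : ∀ a, a ∈ M ∨ -a ∈ M) (harch : ∀ a : A, ∃ r : ℝ, algebraMap ℝ A r - a ∈ M) :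
    ∃ φ : A →ₐ[ℝ] ℝ, ∀ a ∈ M, 0 ≤ φ a := by
  set S : A → Set ℝ := fun a => {r | algebraMap ℝ A r - a ∈ M} with hS
  have cmp : ∀ {a : A} {r s : ℝ}, algebraMap ℝ A r - a ∈ M → a - algebraMap ℝ A s ∈ M →
      s ≤ r := by
    intro a r s hr hs
    have := hM.nonneg_of_algebraMap_mem h1 (r := r - s) (by
      rw [map_sub]; simpa using hM.add_mem _ hr _ hs)
    linarith
  have hne : ∀ a, (S a).Nonempty := harch
  have hbdd : ∀ a, BddBelow (S a) := by
    intro a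
    obtain ⟨N, hN⟩ := harch (-a)
    refine ⟨-N, fun r hr => cmp hr ?_⟩
    rw [map_neg]; convert hN using 1; ring
  set φ : A → ℝ := fun a => sInf (S a) with hφ
  have le_of : ∀ {a : A} {r : ℝ}, algebraMap ℝ A r - a ∈ M → φ a ≤ r :=
    fun {a r} h => csInf_le (hbdd a) h
  have ge_of : ∀ {a : A} {r : ℝ}, a - algebraMap ℝ A r ∈ M → r ≤ φ a :=
    fun {a r} h => le_csInf (hne a) fun s hs => cmp hs h
  have mem_of_lt : ∀ {a : A} {r : ℝ}, φ a < r → algebraMap ℝ A r - a ∈ M := by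
    intro a r h
    obtain ⟨s, hs, hsr⟩ := exists_lt_of_csInf_lt (hne a) h
    have := hM.add_mem _ (hM.algebraMap_mem (sub_nonneg.2 hsr.le)) _ hs
    simpa using this
  have mem_of_gt : ∀ {a : A} {r : ℝ}, r < φ a → a - algebraMap ℝ A r ∈ M := by
    intro a r h
    rcases htot (algebraMap ℝ A r - a) with h' | h'
    · exact absurd (le_of h') (not_le.2 h)
    · simpa using h'
  have hadd : ∀ a b, φ (a + b) = φ a + φ b := by
    intro a b
    refine le_antisymm (le_of_forall_pos_le_add fun ε hε => ?_)
      (le_of_forall_pos_le_add fun ε hε => ?_)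
    · have := hM.add_mem _ (mem_of_lt (show φ a < φ a + ε / 2 by linarith)) _
        (mem_of_lt (show φ b < φ b + ε / 2 by linarith))
      refine (le_of (r := φ a + ε / 2 + (φ b + ε / 2)) ?_).trans (by linarith)
      rw [map_add (algebraMap ℝ A)]
      convert this using 1; ring
    · have := hM.add_mem _ (mem_of_gt (show φ a - ε / 2 < φ a by linarith)) _
        (mem_of_gt (show φ b - ε / 2 < φ b by linarith))
      have := ge_of (a := a + b) (r := φ a - ε / 2 + (φ b - ε / 2)) (by
        rw [map_add (algebraMap ℝ A)]
        convert this using 1; ring)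
      linarith
  have hconst : ∀ r, φ (algebraMap ℝ A r) = r := fun r =>
    le_antisymm (le_of (by simpa using hM.zero_mem)) (ge_of (by simpa using hM.zero_mem))
  have hzero : φ 0 = 0 := by simpa using hconst 0
  have hneg : ∀ a, φ (-a) = -φ a := fun a => by
    have := hadd a (-a); rw [add_neg_cancel, hzero] at this; linarith
  -- With δ = ε / (N + 1), p²a ≤ δp² ≤ δN ≤ ε. This is the step towards the kernel of φ being an
  -- ideal, from which multiplicativity follows.
  have hsq : ∀ a p, φ a = 0 → φ (p ^ 2 * a) ≤ 0 := by
    intro a p ha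
    obtain ⟨N, hN⟩ := harch (p ^ 2)
    have hN0 : 0 ≤ N := hM.nonneg_of_algebraMap_mem h1 (by
      simpa using hM.add_mem _ hN _ (hM.sq_mem p))
    refine le_of_forall_pos_le_add fun ε hε => ?_
    have hδ : 0 < ε / (N + 1) := by positivity
    have h := hM.add_mem _ (hM.smul_mem hδ.le hN) _
      (hM.sq_mul_mem p _ (mem_of_lt (show φ a < ε / (N + 1) by rw [ha]; exact hδ)))
    have h2 : φ (p ^ 2 * a) ≤ ε / (N + 1) * N := le_of (by
      rw [Algebra.smul_def] at h
      rw [map_mul]; convert h using 1; ring)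
    have : ε / (N + 1) * N ≤ ε := by
      rw [div_mul_eq_mul_div, div_le_iff₀ (by positivity)]; nlinarith
    linarith
  have hsq0 : ∀ a p, φ a = 0 → φ (p ^ 2 * a) = 0 := fun a p ha => by
    have h1 := hsq a p ha
    have h2 := hsq (-a) p (by rw [hneg, ha, neg_zero])
    rw [mul_neg, hneg] at h2
    linarith
  have hideal : ∀ a b, φ a = 0 → φ (b * a) = 0 := by
    intro a b ha
    set c : A := algebraMap ℝ A (1 / 2)
    have hc : 4 * c ^ 2 = 1 := by
      rw [← map_pow, ← map_ofNat (algebraMap ℝ A), ← map_mul, ← map_one (algebraMap ℝ A)]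
      norm_num
    have e : b * a = (c * (b + 1)) ^ 2 * a + -((c * (b - 1)) ^ 2 * a) := by
      linear_combination (-(b * a)) * hc
    rw [e, hadd, hneg, hsq0 _ _ ha, hsq0 _ _ ha, neg_zero, add_zero]
  have hsub : ∀ a, φ (a - algebraMap ℝ A (φ a)) = 0 := fun a => by
    rw [sub_eq_add_neg, hadd, hneg, hconst, add_neg_cancel]
  have hmul : ∀ a b, φ (a * b) = φ a * φ b := by
    intro a b
    have h2 := hideal _ (algebraMap ℝ A (φ a)) (hsub b)
    have h3 := hideal _ b (hsub a)
    rw [mul_sub, sub_eq_add_neg, hadd, hneg] at h2 h3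
    rw [← map_mul, hconst] at h2
    rw [mul_comm b a, mul_comm b] at h3
    linarith
  refine ⟨{ toFun := φ
            map_one' := by simpa using hconst 1
            map_mul' := hmul
            map_zero' := hzero
            map_add' := hadd
            commutes' := hconst }, fun a ha => ?_⟩
  exact ge_of (r := 0) (by simpa using ha)

/-- **Jacobi's representation theorem** for archimedean quadratic modules in real algebras. -/
theorem mem_of_forall_algHom_pos (hM : IsQuadraticModule M)
    (harch : ∀ a : A, ∃ r : ℝ, algebraMap ℝ A r - a ∈ M) {a : A}
    (ha : ∀ φ : A →ₐ[ℝ] ℝ, (∀ m ∈ M, 0 ≤ φ m) → 0 < φ a) : a ∈ M := by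
  have harch' : ∀ a : A, ∃ r : ℝ, 0 < r ∧ algebraMap ℝ A r - a ∈ M := by
    intro a
    obtain ⟨r, hr⟩ := harch a
    refine ⟨|r| + 1, by positivity, ?_⟩
    have := hM.add_mem _ hr _
      (hM.algebraMap_mem (r := |r| + 1 - r) (by linarith [le_abs_self r]))
    rw [map_sub] at this
    convert this using 1; ring
  -- Otherwise a maximal proper quadratic module containing M and -a yields a character nonnegative
  -- on M with φ(a) ≤ 0. What results is σa = 1 + m.
  obtain ⟨m, hm, σ, hσ, h⟩ :
      (-1 : A) ∈ {x : A | ∃ m ∈ M, ∃ σ ∈ quadraticModule (∅ : Set A), x = m + σ * -a} := by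
    by_contra hneg
    obtain ⟨P, hle, hP⟩ := (hM.add_sumSq_mul (-a)).exists_maximal hneg
    have hMP : M ⊆ P := fun m hm => hle
      ⟨m, hm, 0, (isQuadraticModule_quadraticModule _).zero_mem, by ring⟩
    obtain ⟨φ, hφ⟩ := hP.prop.1.exists_algHom_of_total hP.prop.2
      (mem_or_neg_mem_of_maximal hP) fun b => (harch b).imp fun _ hr => hMP hr
    have h1 := ha φ fun m hm => hφ m (hMP hm)
    have h2 := hφ (-a) (hle
      ⟨0, hM.zero_mem, 1, (isQuadraticModule_quadraticModule _).one_mem, by ring⟩)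
    rw [map_neg] at h2
    linarith
  -- The constant k is chosen so that σ ≤ 2k and σ²a ≤ 2k - 1.
  obtain ⟨k₁, hk₁, hk₁'⟩ := harch' σ
  obtain ⟨k₂, hk₂, hk₂'⟩ := harch' (σ ^ 2 * a)
  set k : ℝ := k₁ + k₂ + 1 with hk
  have hk0 : 0 < k := by positivity
  have hkσ : algebraMap ℝ A (2 * k) - σ ∈ M := by
    have := hM.add_mem _ hk₁' _ (hM.algebraMap_mem (r := 2 * k - k₁) (by linarith))
    rw [map_sub] at this
    convert this using 1; ring
  have hka : algebraMap ℝ A (2 * k - 1) - σ ^ 2 * a ∈ M := by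
    have := hM.add_mem _ hk₂' _ (hM.algebraMap_mem (r := 2 * k - 1 - k₂) (by linarith))
    rw [map_sub _ (2 * k - 1)] at this
    convert this using 1; ring
  have hprod : σ * (algebraMap ℝ A (2 * k) - σ) ∈ M := by
    have := hM.smul_mem (r := (2 * k)⁻¹) (by positivity) (hM.add_mem _
      (hM.sq_mul_mem σ _ hkσ) _ (hM.sq_mul_mem (algebraMap ℝ A (2 * k) - σ) _ (hM.sumSq_mem hσ)))
    have e : σ ^ 2 * (algebraMap ℝ A (2 * k) - σ) + (algebraMap ℝ A (2 * k) - σ) ^ 2 * σ =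
        (2 * k) • (σ * (algebraMap ℝ A (2 * k) - σ)) := by
      rw [Algebra.smul_def]; ring
    rwa [e, smul_smul, inv_mul_cancel₀ (by positivity), one_smul] at this
  -- k²(a + r) - 1 = (k - σ)²(a + r) + 2km + rσ(2k - σ) + (2k - 1 - σ²a). The decrement 1/k² does
  -- not depend on r, so finitely many steps bring r down to 0.
  have step : ∀ r : ℝ, 0 ≤ r → a + algebraMap ℝ A r ∈ M →
      a + algebraMap ℝ A (r - 1 / k ^ 2) ∈ M := by
    intro r hr hra
    have := hM.smul_mem (r := (k ^ 2)⁻¹) (by positivity) <|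
      hM.add_mem _ (hM.sq_mul_mem (algebraMap ℝ A k - σ) _ hra) _ <|
      hM.add_mem _ (hM.smul_mem (r := 2 * k) (by positivity) hm) _ <|
      hM.add_mem _ (hM.smul_mem hr hprod) _ hka
    convert this using 1
    have e : (algebraMap ℝ A k) ^ 2 * algebraMap ℝ A (1 / k ^ 2) = 1 := by
      rw [← map_pow, ← map_mul, mul_one_div_cancel (by positivity), map_one]
    rw [eq_inv_smul_iff₀ (by positivity)]
    simp only [Algebra.smul_def, map_mul, map_sub, map_pow, map_ofNat, map_one]
    linear_combination (2 * algebraMap ℝ A k) * h - e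
  obtain ⟨r, hr, hra⟩ := harch' (-a)
  have iter : ∀ j : ℕ, ∃ s : ℝ, s ≤ max 0 (r - j * (1 / k ^ 2)) ∧ a + algebraMap ℝ A s ∈ M := by
    intro j
    induction j with
    | zero =>
      refine ⟨r, by simp, ?_⟩
      convert hra using 1; ring
    | succ j ih =>
      obtain ⟨s, hs, hsa⟩ := ih
      rcases le_or_gt s 0 with h0 | h0
      · exact ⟨s, h0.trans (le_max_left _ _), hsa⟩
      · refine ⟨s - 1 / k ^ 2, ?_, step s h0.le hsa⟩
        have hs' : s ≤ r - j * (1 / k ^ 2) := (le_max_iff.1 hs).resolve_left (not_le.2 h0)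
        refine le_max_of_le_right ?_
        push_cast
        linarith
  obtain ⟨j, hj⟩ := exists_nat_ge (r / (1 / k ^ 2))
  obtain ⟨s, hs, hsa⟩ := iter j
  rw [div_le_iff₀ (by positivity)] at hj
  have hs0 : s ≤ 0 := hs.trans (max_le le_rfl (by linarith))
  have := hM.add_mem _ hsa _ (hM.algebraMap_mem (r := -s) (by linarith))
  simpa [add_assoc, ← map_add] using this

end IsQuadraticModule

/-! ### Bounded elements and integrality -/

namespace IsQuadraticModule

variable {A : Type*} [CommRing A] [Algebra ℝ A] {M : Set A}

/-- The elements that are bounded by arbitrarily small multiples of `y ^ (2 * k)`,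
up to a constant. -/
def smallBounded (M : Set A) (y : A) (k : ℕ) : Set A :=
  {z | ∀ δ : ℝ, 0 < δ → ∃ C : ℝ, algebraMap ℝ A C + algebraMap ℝ A δ * y ^ (2 * k) - z ∈ M}

section smallBounded

variable {y : A} {k : ℕ}

theorem algebraMap_mem_smallBounded (hM : IsQuadraticModule M) (c : ℝ) :
    algebraMap ℝ A c ∈ smallBounded M y k := fun δ hδ => ⟨c, by
  have := hM.smul_mem hδ.le (hM.sq_mem (y ^ k))
  rw [Algebra.smul_def, ← pow_mul, mul_comm k] at this
  simpa using this⟩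

theorem add_mem_smallBounded (hM : IsQuadraticModule M) {z w : A}
    (hz : z ∈ smallBounded M y k) (hw : w ∈ smallBounded M y k) :
    z + w ∈ smallBounded M y k := by
  intro δ hδ
  obtain ⟨C, hC⟩ := hz (δ / 2) (by positivity)
  obtain ⟨D, hD⟩ := hw (δ / 2) (by positivity)
  refine ⟨C + D, ?_⟩
  have e : algebraMap ℝ A δ = algebraMap ℝ A (δ / 2) + algebraMap ℝ A (δ / 2) := by
    rw [← map_add, add_halves]
  rw [e, map_add]
  convert hM.add_mem _ hC _ hD using 1
  ring

theorem sum_mem_smallBounded (hM : IsQuadraticModule M) {ι : Type*} (s : Finset ι) (z : ι → A)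
    (hz : ∀ i ∈ s, z i ∈ smallBounded M y k) : ∑ i ∈ s, z i ∈ smallBounded M y k :=
  Finset.sum_induction z (· ∈ smallBounded M y k) (fun _ _ => hM.add_mem_smallBounded)
    (by simpa using hM.algebraMap_mem_smallBounded (y := y) (k := k) 0) hz

theorem smul_mem_smallBounded (hM : IsQuadraticModule M) {z : A}
    (hz : z ∈ smallBounded M y k) {r : ℝ} (hr : 0 < r) : r • z ∈ smallBounded M y k := by
  intro δ hδ
  obtain ⟨C, hC⟩ := hz (δ / r) (by positivity)
  refine ⟨r * C, ?_⟩
  convert hM.smul_mem hr.le hC using 1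
  rw [Algebra.smul_def, Algebra.smul_def, mul_sub, mul_add, ← map_mul, ← mul_assoc, ← map_mul,
    mul_div_cancel₀ _ hr.ne']

theorem mem_smallBounded_of_sub_mem (hM : IsQuadraticModule M) {z w : A}
    (hz : z ∈ smallBounded M y k) (h : z - w ∈ M) : w ∈ smallBounded M y k := by
  intro δ hδ
  obtain ⟨C, hC⟩ := hz δ hδ
  exact ⟨C, by simpa using hM.add_mem _ hC _ h⟩

theorem pow_mem_smallBounded_succ (hM : IsQuadraticModule M) (y : A) (k : ℕ) :
    y ^ (2 * k) ∈ smallBounded M y (k + 1) := by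
  induction k with
  | zero => simpa using hM.algebraMap_mem_smallBounded (y := y) (k := 1) 1
  | succ k ih =>
    intro δ hδ
    obtain ⟨C, hC⟩ := ih δ hδ
    refine ⟨δ⁻¹ * C, ?_⟩
    -- Expanding the square gives 2δy^(2k+2) ≤ δ²y^(2k+4) + y^(2k); the induction hypothesis absorbs
    -- y^(2k) at the cost of δy^(2k+2) and C.
    have h := hM.smul_mem (r := δ⁻¹) (by positivity) <| hM.add_mem _
      (hM.sq_mem ((algebraMap ℝ A δ * y ^ 2 - 1) * y ^ k)) _ hC
    convert h using 1
    rw [eq_inv_smul_iff₀ hδ.ne', Algebra.smul_def]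
    have e : algebraMap ℝ A δ * algebraMap ℝ A δ⁻¹ = 1 := by
      rw [← map_mul, mul_inv_cancel₀ hδ.ne', map_one]
    rw [map_mul]
    linear_combination (algebraMap ℝ A C) * e

theorem pow_mem_smallBounded (hM : IsQuadraticModule M) (y : A) {i k : ℕ} (hik : i < k) :
    y ^ (2 * i) ∈ smallBounded M y k := by
  induction k, hik using Nat.le_induction with
  | base => exact hM.pow_mem_smallBounded_succ y i
  | succ k hk ih =>
    intro δ hδ
    obtain ⟨C, hC⟩ := ih δ hδ
    obtain ⟨D, hD⟩ := hM.pow_mem_smallBounded_succ y k 1 one_pos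
    refine ⟨C + δ * D, ?_⟩
    convert hM.add_mem _ hC _ (hM.smul_mem hδ.le hD) using 1
    rw [Algebra.smul_def, map_add, map_mul, map_one]
    ring

/-- With a² ≤ s: for even exponents use 2a ≤ a² + 1; for odd ones use 2δay ≤ a² + δ²y², multiplied
by y^(2i). -/
theorem mul_pow_mem_smallBounded (hM : IsQuadraticModule M) {a : A} {r : ℝ}
    (ha : algebraMap ℝ A r - a ^ 2 ∈ M) (y : A) {j k : ℕ} (hj : j < 2 * k) :
    a * y ^ j ∈ smallBounded M y k := by
  have ha' : algebraMap ℝ A (|r| + 1) - a ^ 2 ∈ M := by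
    have := hM.add_mem _ ha _
      (hM.algebraMap_mem (r := |r| + 1 - r) (by linarith [le_abs_self r]))
    rw [map_sub] at this
    convert this using 1; ring
  have hr : 0 < |r| + 1 := by positivity
  generalize |r| + 1 = s at ha' hr
  obtain ⟨i, rfl | rfl⟩ := Nat.even_or_odd' j
  · refine hM.mem_smallBounded_of_sub_mem (hM.smul_mem_smallBounded
      (hM.pow_mem_smallBounded y (show i < k by omega)) (r := (s + 1) / 2) (by positivity)) ?_
    have h := hM.smul_mem (r := 1 / 2) (by norm_num) <| hM.sq_mul_mem (y ^ i) _ <|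
      hM.add_mem _ ha' _ (hM.sq_mem (a - 1))
    convert h using 1
    have e : algebraMap ℝ A (1 / 2) * 2 = 1 := by
      rw [← map_ofNat (algebraMap ℝ A), ← map_mul, ← map_one (algebraMap ℝ A)]; norm_num
    rw [Algebra.smul_def, Algebra.smul_def, div_eq_mul_one_div, map_mul, map_add, map_one]
    linear_combination (a * y ^ (2 * i)) * e
  · intro δ hδ
    obtain ⟨C, hC⟩ := hM.smul_mem_smallBounded (hM.pow_mem_smallBounded y (show i < k by omega))
      (r := s / (2 * δ)) (by positivity) (δ / 2) (by positivity)
    -- The exponent i + 1 may equal k, where `pow_mem_smallBounded` does not apply.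
    obtain ⟨D, hD⟩ : ∃ D : ℝ,
        algebraMap ℝ A D + y ^ (2 * k) - y ^ (2 * (i + 1)) ∈ M := by
      rcases (show i + 1 ≤ k by omega).eq_or_lt with h | h
      · exact ⟨0, by simpa [h] using hM.zero_mem⟩
      · simpa using hM.pow_mem_smallBounded y h 1 one_pos
    refine ⟨C + δ / 2 * D, ?_⟩
    have h := hM.add_mem _ hC _ <| hM.add_mem _ (hM.smul_mem (r := δ / 2) (by positivity) hD) _ <|
      hM.add_mem _ (hM.smul_mem (r := 1 / (2 * δ)) (by positivity)
        (hM.sq_mul_mem (y ^ i) _ ha')) _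
      (hM.smul_mem (r := 1 / (2 * δ)) (by positivity)
        (hM.sq_mem ((a - algebraMap ℝ A δ * y) * y ^ i)))
    convert h using 1
    have e : algebraMap ℝ A (1 / (2 * δ)) * algebraMap ℝ A δ * 2 = 1 := by
      rw [← map_ofNat (algebraMap ℝ A), ← map_mul, ← map_mul, ← map_one (algebraMap ℝ A)]
      congr 1; field_simp
    have e' : algebraMap ℝ A (δ / 2) * 2 = algebraMap ℝ A δ := by
      rw [← map_ofNat (algebraMap ℝ A), ← map_mul]
      congr 1; ring
    simp only [Algebra.smul_def]
    rw [div_eq_mul_one_div s, map_mul, map_add, map_mul, ← e']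
    rw [← e'] at e
    linear_combination
      (-(a * y ^ (2 * i + 1)) + algebraMap ℝ A (δ / 2) * y ^ (2 * i + 2)) * (-e)

end smallBounded

/-- The elements bounded with respect to a quadratic module are integrally closed. -/
theorem exists_sub_sq_mem_of_isIntegral (hM : IsQuadraticModule M) {R : Type*} [CommRing R]
    [Algebra R A] (hR : ∀ a : R, ∃ r : ℝ, algebraMap ℝ A r - algebraMap R A a ^ 2 ∈ M)
    {y : A} (hy : IsIntegral R y) : ∃ r : ℝ, algebraMap ℝ A r - y ^ 2 ∈ M := by
  rcases subsingleton_or_nontrivial R with _ | _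
  · have h : (1 : A) = 0 := by
      rw [← map_one (algebraMap R A), Subsingleton.elim (1 : R) 0, map_zero]
    have := subsingleton_of_zero_eq_one h.symm
    exact ⟨0, by simpa [Subsingleton.elim y 0] using hM.zero_mem⟩
  obtain ⟨p, hp, hpy⟩ := hy
  -- Multiplying p by a power of X makes the degree even, equal to 2k with k > 1.
  set k := p.natDegree + 2 with hk
  set q := p * Polynomial.X ^ (p.natDegree + 4) with hq
  have hqm : q.Monic := hp.mul (Polynomial.monic_X_pow _)
  have hqd : q.natDegree = 2 * k := by
    rw [hq, hp.natDegree_mul (Polynomial.monic_X_pow _), Polynomial.natDegree_X_pow]; omega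
  have hqy : Polynomial.aeval y q = 0 := by
    rw [hq, map_mul, Polynomial.aeval_def, hpy, zero_mul]
  have hsum : y ^ (2 * k) = ∑ i ∈ Finset.range (2 * k), algebraMap R A (-q.coeff i) * y ^ i := by
    rw [hqm.as_sum, hqd] at hqy
    simp only [map_add, map_pow, Polynomial.aeval_X, map_sum, map_mul, Polynomial.aeval_C] at hqy
    simp only [map_neg, neg_mul, Finset.sum_neg_distrib]
    exact eq_neg_of_add_eq_zero_left hqy
  have hmem : y ^ (2 * k) ∈ smallBounded M y k := by
    rw [hsum]
    refine hM.sum_mem_smallBounded _ _ fun i hi => ?_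
    obtain ⟨r, hr⟩ := hR (-q.coeff i)
    exact hM.mul_pow_mem_smallBounded hr y (Finset.mem_range.1 hi)
  obtain ⟨C, hC⟩ := hmem (1 / 2) (by norm_num)
  obtain ⟨D, hD⟩ := hM.pow_mem_smallBounded y (show 1 < k by omega) (1 / 2) (by norm_num)
  -- Adding y^(2k) ≤ C + y^(2k)/2 and y² ≤ D + y^(2k)/2 cancels the top power.
  refine ⟨C + D, ?_⟩
  convert hM.add_mem _ hC _ hD using 1
  have e : algebraMap ℝ A (1 / 2) * 2 = 1 := by
    rw [← map_ofNat (algebraMap ℝ A), ← map_mul, ← map_one (algebraMap ℝ A)]; norm_num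
  rw [map_add]
  linear_combination (-y ^ (2 * k)) * e

end IsQuadraticModule

theorem exists_algebraMap_sub_mem_of_sq {A : Type*} [CommRing A] [Algebra ℝ A] {M : Set A}
    (hM : IsQuadraticModule M) {a : A} {r : ℝ} (h : algebraMap ℝ A r - a ^ 2 ∈ M) :
    algebraMap ℝ A (r + 1 / 4) - a ∈ M := by
  convert hM.add_mem _ h _ (hM.sq_mem (a - algebraMap ℝ A (1 / 2))) using 1
  have e : algebraMap ℝ A (1 / 2) * 2 = 1 := by
    rw [← map_ofNat (algebraMap ℝ A), ← map_mul, ← map_one (algebraMap ℝ A)]; norm_num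
  have e' : algebraMap ℝ A (1 / 4) = algebraMap ℝ A (1 / 2) ^ 2 := by
    rw [← map_pow]; congr 1; norm_num
  rw [map_add, e']
  linear_combination a * e

/-! ### The ring ℝ[X, f]: boundedness, characters and eigenvectors -/

section

variable {n t : ℕ} (G : Set (MvPolynomial (Fin n) ℝ))
  (f : Matrix (Fin t) (Fin t) (MvPolynomial (Fin n) ℝ))

theorem algebraMap_mem_quadraticModule_image {g : MvPolynomial (Fin n) ℝ}
    (hg : g ∈ quadraticModule G) :
    algebraMap (MvPolynomial (Fin n) ℝ) (polyAdjoin f) g ∈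
      quadraticModule (algebraMap (MvPolynomial (Fin n) ℝ) (polyAdjoin f) '' G) := by
  set Q := quadraticModule (algebraMap (MvPolynomial (Fin n) ℝ) (polyAdjoin f) '' G)
  have hQ : IsQuadraticModule Q := isQuadraticModule_quadraticModule _
  have h : IsQuadraticModule (algebraMap (MvPolynomial (Fin n) ℝ) (polyAdjoin f) ⁻¹' Q) :=
    { one_mem := by simpa using hQ.one_mem
      add_mem := fun a ha b hb => by simpa using hQ.add_mem _ ha _ hb
      sq_mul_mem := fun p a ha => by simpa using hQ.sq_mul_mem _ _ ha }
  exact quadraticModule_subset h (fun a ha => subset_quadraticModule _ ⟨a, ha, rfl⟩) hg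

/-- The matrix ring is finite over ℝ[X], so its elements, and hence those of ℝ[X, f], are integral.
-/
theorem polyAdjoin_archimedean (hG : IsArchimedeanModule (quadraticModule G))
    (a : polyAdjoin f) : ∃ r : ℝ, algebraMap ℝ (polyAdjoin f) r - a ∈
      quadraticModule (algebraMap (MvPolynomial (Fin n) ℝ) (polyAdjoin f) '' G) := by
  have hQ := isQuadraticModule_quadraticModule
    (algebraMap (MvPolynomial (Fin n) ℝ) (polyAdjoin f) '' G)
  have hint : IsIntegral (MvPolynomial (Fin n) ℝ) a :=
    (isIntegral_algHom_iff (polyAdjoin f).val Subtype.val_injective).1 (IsIntegral.of_finite _ _)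
  obtain ⟨r, hr⟩ := hQ.exists_sub_sq_mem_of_isIntegral (fun b => by
    obtain ⟨N, hN⟩ := hG b
    refine ⟨N, ?_⟩
    simpa using algebraMap_mem_quadraticModule_image G f hN) hint
  exact ⟨_, exists_algebraMap_sub_mem_of_sq hQ hr⟩

theorem algHom_algebraMap (φ : polyAdjoin f →ₐ[ℝ] ℝ) (g : MvPolynomial (Fin n) ℝ) :
    φ (algebraMap (MvPolynomial (Fin n) ℝ) (polyAdjoin f) g) = MvPolynomial.eval
      (fun i => φ (algebraMap (MvPolynomial (Fin n) ℝ) (polyAdjoin f) (MvPolynomial.X i))) g := by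
  have h : φ.comp (IsScalarTower.toAlgHom ℝ (MvPolynomial (Fin n) ℝ) (polyAdjoin f)) =
      MvPolynomial.aeval fun i =>
        φ (algebraMap (MvPolynomial (Fin n) ℝ) (polyAdjoin f) (MvPolynomial.X i)) := by
    ext i; simp
  exact DFunLike.congr_fun h g

/-- A real point of `ℝ[X, f]` lying over `x` sends `f` to an eigenvalue of `f(x)`. -/
theorem hasEigenvalue_of_algHom (φ : polyAdjoin f →ₐ[ℝ] ℝ) :
    Module.End.HasEigenvalue (Matrix.toLin' (matrixEval
      (fun i => φ (algebraMap (MvPolynomial (Fin n) ℝ) (polyAdjoin f) (MvPolynomial.X i))) f))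
      (φ ⟨f, Algebra.self_mem_adjoin_singleton _ f⟩) := by
  set x : Fin n → ℝ :=
    fun i => φ (algebraMap (MvPolynomial (Fin n) ℝ) (polyAdjoin f) (MvPolynomial.X i))
  set F : polyAdjoin f := ⟨f, Algebra.self_mem_adjoin_singleton _ f⟩
  -- Cayley–Hamilton, pulled back to the subring on which φ is defined.
  have h : Polynomial.aeval F f.charpoly = 0 := by
    apply Subtype.val_injective
    have := Polynomial.aeval_algHom_apply (polyAdjoin f).val F f.charpoly
    exact this.symm.trans f.aeval_self_charpoly
  have hcomp : (φ : polyAdjoin f →+* ℝ).comp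
      (algebraMap (MvPolynomial (Fin n) ℝ) (polyAdjoin f)) = MvPolynomial.eval x :=
    RingHom.ext fun g => algHom_algebraMap f φ g
  rw [Module.End.hasEigenvalue_iff_isRoot_charpoly, Matrix.charpoly_toLin', matrixEval,
    Matrix.charpoly_map, Polynomial.IsRoot.def, Polynomial.eval_map, ← hcomp]
  have h' := congrArg (φ : polyAdjoin f →+* ℝ) h
  rwa [Polynomial.aeval_def, Polynomial.hom_eval₂, map_zero] at h'

theorem matrixEval_eq_mapMatrix (x : Fin n → ℝ) :
    matrixEval x f = (MvPolynomial.eval x).mapMatrix f := rfl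

theorem matrixEval_algebraMap (x : Fin n → ℝ) (g : MvPolynomial (Fin n) ℝ) :
    matrixEval x (algebraMap _ (Matrix (Fin t) (Fin t) (MvPolynomial (Fin n) ℝ)) g) =
      algebraMap ℝ (Matrix (Fin t) (Fin t) ℝ) (MvPolynomial.eval x g) := by
  ext i j
  by_cases hij : i = j <;> simp [matrixEval, Matrix.algebraMap_matrix_apply, hij]

theorem algebraMap_mulVec (c : ℝ) (v : Fin t → ℝ) :
    (algebraMap ℝ (Matrix (Fin t) (Fin t) ℝ) c).mulVec v = c • v := by
  rw [Algebra.algebraMap_eq_smul_one, Matrix.smul_mulVec, Matrix.one_mulVec]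

/-- The elements of `ℝ[X, f]` act by scalars on the eigenvectors of `f(x)`. -/
theorem exists_matrixEval_mulVec_eq {x : Fin n → ℝ} {v : Fin t → ℝ} {r : ℝ}
    (hv : (matrixEval x f).mulVec v = r • v) (a : polyAdjoin f) :
    ∃ c : ℝ, (matrixEval x (a : Matrix (Fin t) (Fin t) (MvPolynomial (Fin n) ℝ))).mulVec v =
      c • v := by
  obtain ⟨a, ha⟩ := a
  induction ha using Algebra.adjoin_induction with
  | mem b hb => obtain rfl : b = f := hb; exact ⟨r, hv⟩
  | algebraMap g => exact ⟨_, by rw [matrixEval_algebraMap, algebraMap_mulVec]⟩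
  | add b c _ _ hb hc =>
    obtain ⟨β, hβ⟩ := hb
    obtain ⟨γ, hγ⟩ := hc
    refine ⟨β + γ, ?_⟩
    rw [matrixEval_eq_mapMatrix] at hβ hγ ⊢
    rw [map_add, Matrix.add_mulVec, hβ, hγ, add_smul]
  | mul b c _ _ hb hc =>
    obtain ⟨β, hβ⟩ := hb
    obtain ⟨γ, hγ⟩ := hc
    refine ⟨β * γ, ?_⟩
    rw [matrixEval_eq_mapMatrix] at hβ hγ ⊢
    rw [map_mul, ← Matrix.mulVec_mulVec, hγ, Matrix.mulVec_smul, hβ, smul_smul, mul_comm]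

/-- The elements of the quadratic module `Q_G^f` act by nonnegative scalars on the eigenvectors
of `f(x)` for `x ∈ S_G`. -/
theorem exists_nonneg_matrixEval_mulVec_eq {x : Fin n → ℝ} (hx : x ∈ nonnegSet G)
    {v : Fin t → ℝ} {r : ℝ} (hv : (matrixEval x f).mulVec v = r • v)
    {a : Matrix (Fin t) (Fin t) (MvPolynomial (Fin n) ℝ)} (ha : a ∈ quadraticModuleAdjoin G f) :
    ∃ c : ℝ, 0 ≤ c ∧ (matrixEval x a).mulVec v = c • v := by
  obtain ⟨b, hb, rfl⟩ := ha
  have hM : IsQuadraticModule {b : polyAdjoin f | ∃ c : ℝ, 0 ≤ c ∧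
      (matrixEval x (b : Matrix (Fin t) (Fin t) (MvPolynomial (Fin n) ℝ))).mulVec v = c • v} :=
    { one_mem := ⟨1, zero_le_one, by
        rw [matrixEval_eq_mapMatrix, OneMemClass.coe_one, map_one, Matrix.one_mulVec, one_smul]⟩
      add_mem := by
        rintro b ⟨β, hβ0, hβ⟩ c ⟨γ, hγ0, hγ⟩
        refine ⟨β + γ, add_nonneg hβ0 hγ0, ?_⟩
        rw [matrixEval_eq_mapMatrix] at hβ hγ ⊢
        rw [AddMemClass.coe_add, map_add, Matrix.add_mulVec, hβ, hγ, add_smul]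
      sq_mul_mem := by
        rintro p b ⟨β, hβ0, hβ⟩
        obtain ⟨c, hc⟩ := exists_matrixEval_mulVec_eq f hv p
        refine ⟨c ^ 2 * β, by positivity, ?_⟩
        rw [matrixEval_eq_mapMatrix] at hβ hc ⊢
        rw [pow_two, MulMemClass.coe_mul, MulMemClass.coe_mul, map_mul, map_mul,
          ← Matrix.mulVec_mulVec, hβ, Matrix.mulVec_smul, ← Matrix.mulVec_mulVec, hc,
          Matrix.mulVec_smul, hc, smul_smul, smul_smul]
        congr 1; ring }
  refine quadraticModule_subset hM ?_ hb
  rintro _ ⟨g, hg, rfl⟩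
  exact ⟨_, hx g hg, by
    rw [← algebraMap_mulVec, ← matrixEval_algebraMap]; rfl⟩

end

theorem corollary20 {n t : ℕ} (G : Set (MvPolynomial (Fin n) ℝ))
    (hG : IsArchimedeanModule (quadraticModule G))
    (f : Matrix (Fin t) (Fin t) (MvPolynomial (Fin n) ℝ)) :
    (∀ x ∈ nonnegSet G, ∀ r : ℝ,
        Module.End.HasEigenvalue (Matrix.toLin' (matrixEval x f)) r → 0 ≤ r) ↔
      ∀ ε : ℝ, 0 < ε →
        f + algebraMap ℝ (Matrix (Fin t) (Fin t) (MvPolynomial (Fin n) ℝ)) ε ∈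
          quadraticModuleAdjoin G f := by
  constructor
  · intro h ε hε
    refine ⟨⟨f, Algebra.self_mem_adjoin_singleton _ f⟩ + algebraMap ℝ (polyAdjoin f) ε, ?_, rfl⟩
    refine (isQuadraticModule_quadraticModule _).mem_of_forall_algHom_pos
      (polyAdjoin_archimedean G f hG) fun φ hφ => ?_
    have hr := h _ (fun g hg => ?_) _ (hasEigenvalue_of_algHom f φ)
    · rw [map_add, AlgHom.commutes]
      exact add_pos_of_nonneg_of_pos hr hε
    · rw [← algHom_algebraMap]
      exact hφ _ (subset_quadraticModule _ ⟨g, hg, rfl⟩)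
  · intro h x hx r hr
    obtain ⟨v, hv⟩ := hr.exists_hasEigenvector
    have hv' : (matrixEval x f).mulVec v = r • v := by
      simpa using hv.apply_eq_smul
    refine le_of_forall_pos_le_add fun ε hε => ?_
    obtain ⟨c, hc, hcv⟩ := exists_nonneg_matrixEval_mulVec_eq G f hx hv' (h ε hε)
    have e : (r + ε) • v = c • v := by
      rw [← hcv, matrixEval_eq_mapMatrix, map_add, Matrix.add_mulVec, ← matrixEval_eq_mapMatrix,
        ← matrixEval_eq_mapMatrix, hv', IsScalarTower.algebraMap_apply ℝ (MvPolynomial (Fin n) ℝ),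
        matrixEval_algebraMap, algebraMap_mulVec, add_smul]
      simp
    rwa [smul_left_injective ℝ hv.2 e]
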